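/- Let $K$ be a field and let $E=(E^0,E^1,s,r)$ be any directed graph. Let $L_K(E)$ be the Leavitt path algebra of $E$, that is, the (in general non-unital) $K$-algebra generated by the vertices, the edges $f$ and the ghost edges $f^*$, subject to the relations of the path algebra of the double graph (where $f^*$ runs from $r(f)$ to $s(f)$) and to $f^*g=\delta_{f,g}\,r(f)$ for $f,g\in E^1$ and $v=\sum_{s(f)=v}ff^*$ for every vertex $v$ with $0<|s^{-1}(v)|<\infty$. "Module" means left module $M$ over $L_K(E)$ that is unital, i.e. $L_K(E)M=M$; projectivity and finite presentation refer to such modules, where $M$ is finitely presented if there is an exact sequence $P_1\to P_0\to M\to 0$ with $P_0,P_1$ finitely generated and projective. Let $e=e_1\cdots e_N$ ($N\ge 1$) be a simple closed path in $E$, that is, $r(e_i)=s(e_{i+1})$ for $1\le i<N$, $r(e_N)=s(e_1)$, and $s(e_i)\neq s(e_1)$ for $1<i\le N$ (for instance, any cycle); put $s(e)=s(e_1)$. Let $0\neq a\in K$. Let $V_{[e^\infty]}$ be the $K$-vector space whose basis is the set of infinite paths of the form $\lambda e^\infty$ with $\lambda$ a finite path (possibly a vertex) and $e^\infty=eee\cdots$,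 on which a vertex $v$ fixes the basis elements starting at $v$ and kills the others, an edge $f$ sends a basis element $q$ to $fq$ if $q$ starts at $r(f)$ and to $0$ otherwise, and $f^*$ sends $fq$ to $q$ and kills the basis elements whose first edge is not $f$. Let $\sigma_{e,a}$ be the automorphism of the $K$-algebra $L_K(E)$ with $e_1\mapsto ae_1$, $e_1^*\mapsto a^{-1}e_1^*$ that fixes all vertices and all other edges and ghost edges, and let $V_{[e^\infty]}^{\sigma_{e,a}}$ be the abelian group $V_{[e^\infty]}$ with the action $\ell\star m=\sigma_{e,a}(\ell)m$. Then the module $V_{[e^\infty]}^{\sigma_{e,a}}$ is finitely presented, and a projective resolution of it is given by $$0\longrightarrow L_K(E)\,(a^{-1}e-s(e))\xrightarrow{\ \iota\ }L_K(E)\,s(e)\xrightarrow{\ \rho_{e^\infty}\circ\sigma_{e,a}\ }V_{[e^\infty]}^{\sigma_{e,a}}\longrightarrow 0,$$ where $\iota$ is the inclusion and $\rho_{e^\infty}\circ\sigma_{e,a}$ is the map $y\mapsto \sigma_{e,a}(y)\,e^\infty$; that is, the sequence is exact and both $L_K(E)(a^{-1}e-s(e))$ and $L_K(E)s(e)$ are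 projective modules. -/

import Mathlib

universe u v w x

/-- A directed graph `(E⁰, E¹, s, r)`; no finiteness or countability condition. -/
structure DirGraph where
  /-- the vertices -/
  Vertex : Type u
  /-- the edges -/
  Edge : Type v
  /-- the source map -/
  s : Edge → Vertex
  /-- the range map -/
  r : Edge → Vertex

namespace DirGraph

/-- A closed path `e₁ e₂ ⋯ e_N` of length `N = n + 1 ≥ 1`, where `edge i` is `e_{i+1}`. In `chain`
the index `i + 1` is computed in `Fin (n + 1)`, that is, modulo `N`; so for the last edge the
condition says `r(e_N) = s(e₁)`. -/
structure ClosedPath (E : DirGraph.{u, v}) where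
  /-- the length minus one -/
  n : ℕ
  /-- the edges -/
  edge : Fin (n + 1) → E.Edge
  chain : ∀ i, E.r (edge i) = E.s (edge (i + 1))

/-- An infinite path. -/
structure InfPath (E : DirGraph.{u, v}) where
  /-- the edges -/
  edge : ℕ → E.Edge
  chain : ∀ i, E.r (edge i) = E.s (edge (i + 1))

namespace ClosedPath

variable {E : DirGraph.{u, v}}

/-- The vertex `s(e)` at which the closed path `e` is based. -/
def base (e : E.ClosedPath) : E.Vertex := E.s (e.edge 0)

/-- `e` is a cycle: `s(eᵢ) ≠ s(eⱼ)` for all `i ≠ j`. -/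
def IsCycle (e : E.ClosedPath) : Prop := ∀ i j, i ≠ j → E.s (e.edge i) ≠ E.s (e.edge j)

/-- `e` is a simple closed path: it does not return to its base before its end, that is,
`s(eᵢ) ≠ s(e₁)` for all `i ≠ 1`. -/
def IsSimple (e : E.ClosedPath) : Prop := ∀ i, i ≠ 0 → E.s (e.edge i) ≠ E.s (e.edge 0)

theorem IsCycle.isSimple {e : E.ClosedPath} (h : e.IsCycle) : e.IsSimple := fun i hi => h i 0 hi

/-- The infinite path `e^∞ = e e e ⋯`: its `i`-th edge is the edge of `e` of index `i` modulo the
length of `e`. -/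
def inf (e : E.ClosedPath) : E.InfPath where
  edge i := e.edge (Fin.ofNat (e.n + 1) i)
  chain i := by
    rw [e.chain]
    congr 2
    ext
    simp [Fin.val_add]

theorem inf_add_period (e : E.ClosedPath) (i : ℕ) :
    e.inf.edge (i + (e.n + 1)) = e.inf.edge i := by
  simp only [inf]
  congr 1
  ext
  simp

end ClosedPath

namespace InfPath

variable {E : DirGraph.{u, v}}

/-- The vertex at which an infinite path starts. -/
def source (p : E.InfPath) : E.Vertex := E.s (p.edge 0)

/-- The infinite path `f p`, for an edge `f` that ends where `p` starts. -/
def cons (f : E.Edge) (p : E.InfPath) (h : E.r f = p.source) : E.InfPath where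
  edge i := Nat.casesOn i f p.edge
  chain i := by
    cases i with
    | zero => exact h
    | succ i => exact p.chain i

/-- The infinite path `p` without its first edge. -/
def tail (p : E.InfPath) : E.InfPath where
  edge i := p.edge (i + 1)
  chain i := p.chain (i + 1)

/-- `p = lam e^∞` for some finite path `lam`, of length `m`; the path `lam` then consists of the
first `m` edges of `p`. -/
def IsTailOf (e : E.ClosedPath) (p : E.InfPath) : Prop :=
  ∃ m : ℕ, ∀ i, p.edge (m + i) = e.inf.edge i

theorem isTailOf_inf (e : E.ClosedPath) : IsTailOf e e.inf := ⟨0, fun i => by rw [Nat.zero_add]⟩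

theorem IsTailOf.cons {e : E.ClosedPath} {p : E.InfPath} (hp : IsTailOf e p) (f : E.Edge)
    (h : E.r f = p.source) : IsTailOf e (p.cons f h) := by
  obtain ⟨m, hm⟩ := hp
  refine ⟨m + 1, fun i => ?_⟩
  rw [show m + 1 + i = (m + i) + 1 by omega]
  exact hm i

theorem IsTailOf.tail {e : E.ClosedPath} {p : E.InfPath} (hp : IsTailOf e p) :
    IsTailOf e p.tail := by
  obtain ⟨m, hm⟩ := hp
  refine ⟨m + e.n, fun i => ?_⟩
  change p.edge (m + e.n + i + 1) = _
  rw [show m + e.n + i + 1 = m + (i + (e.n + 1)) by omega, hm, e.inf_add_period]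

end InfPath

/-- Generators of the Leavitt path algebra: vertices, edges `f`, and ghost edges `f*`. -/
inductive Gen (E : DirGraph.{u, v}) : Type (max u v)
  | vertex (a : E.Vertex) : Gen E
  | edge (f : E.Edge) : Gen E
  | ghost (f : E.Edge) : Gen E

section Leavitt

variable (E : DirGraph.{u, v}) (K : Type w) [Field K]

open Classical in
/-- The defining relations of the Leavitt path algebra. The first six are those of the path algebra
of the double graph, in which `f*` runs from `r(f)` to `s(f)`; `ck1` and `ck2` are the
Cuntz-Krieger relations. -/
inductive Rel : FreeAlgebra K E.Gen → FreeAlgebra K E.Gen → Prop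
  | vertex_mul_self (a : E.Vertex) :
      Rel (FreeAlgebra.ι K (Gen.vertex a) * FreeAlgebra.ι K (Gen.vertex a))
        (FreeAlgebra.ι K (Gen.vertex a))
  | vertex_mul_vertex (a b : E.Vertex) (h : a ≠ b) :
      Rel (FreeAlgebra.ι K (Gen.vertex a) * FreeAlgebra.ι K (Gen.vertex b)) 0
  | source_mul_edge (f : E.Edge) :
      Rel (FreeAlgebra.ι K (Gen.vertex (E.s f)) * FreeAlgebra.ι K (Gen.edge f))
        (FreeAlgebra.ι K (Gen.edge f))
  | edge_mul_range (f : E.Edge) :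
      Rel (FreeAlgebra.ι K (Gen.edge f) * FreeAlgebra.ι K (Gen.vertex (E.r f)))
        (FreeAlgebra.ι K (Gen.edge f))
  | range_mul_ghost (f : E.Edge) :
      Rel (FreeAlgebra.ι K (Gen.vertex (E.r f)) * FreeAlgebra.ι K (Gen.ghost f))
        (FreeAlgebra.ι K (Gen.ghost f))
  | ghost_mul_source (f : E.Edge) :
      Rel (FreeAlgebra.ι K (Gen.ghost f) * FreeAlgebra.ι K (Gen.vertex (E.s f)))
        (FreeAlgebra.ι K (Gen.ghost f))
  | ck1 (f g : E.Edge) :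
      Rel (FreeAlgebra.ι K (Gen.ghost f) * FreeAlgebra.ι K (Gen.edge g))
        (if f = g then FreeAlgebra.ι K (Gen.vertex (E.r f)) else 0)
  | ck2 (a : E.Vertex) (hfin : {f : E.Edge | E.s f = a}.Finite)
      (hne : {f : E.Edge | E.s f = a}.Nonempty) :
      Rel (FreeAlgebra.ι K (Gen.vertex a))
        (∑ f ∈ hfin.toFinset, FreeAlgebra.ι K (Gen.edge f) * FreeAlgebra.ι K (Gen.ghost f))

/-- The *unital* `K`-algebra with the above generators and relations. As the relations have no
constant term, it is `K ⊕ L_K(E)`, the Leavitt path algebra with a unit adjoined. -/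
abbrev LeavittUnitization : Type (max u v w) := RingQuot (Rel E K)

/-- The image of a generator. -/
def gen (g : E.Gen) : LeavittUnitization E K :=
  RingQuot.mkAlgHom K (Rel E K) (FreeAlgebra.ι K g)

/-- The non-unital subalgebra generated by the vertices, the edges and the ghost edges. -/
def leavittSubalgebra : NonUnitalSubalgebra K (LeavittUnitization E K) :=
  NonUnitalAlgebra.adjoin K (Set.range (gen E K))

/-- The Leavitt path algebra `L_K(E)`: the (in general non-unital) `K`-algebra presented by the
generators `Gen E` and the relations `Rel E K`. It is realized as the set of non-commutative
polynomials without constant term in the generators, modulo the ideal generated by the relations. -/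
def Leavitt : Type (max u v w) := leavittSubalgebra E K

instance : NonUnitalRing (Leavitt E K) := inferInstanceAs (NonUnitalRing (leavittSubalgebra E K))

instance : Module K (Leavitt E K) := inferInstanceAs (Module K (leavittSubalgebra E K))

instance : IsScalarTower K (Leavitt E K) (Leavitt E K) :=
  inferInstanceAs (IsScalarTower K (leavittSubalgebra E K) (leavittSubalgebra E K))

instance : SMulCommClass K (Leavitt E K) (Leavitt E K) :=
  inferInstanceAs (SMulCommClass K (leavittSubalgebra E K) (leavittSubalgebra E K))

variable {E K} in
/-- The inclusion of `L_K(E)` in its unitization. -/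
def Leavitt.val : Leavitt E K →ₙₐ[K] LeavittUnitization E K where
  toFun y := y.1
  map_smul' _ _ := rfl
  map_zero' := rfl
  map_add' _ _ := rfl
  map_mul' _ _ := rfl

variable {E K} in
theorem Leavitt.ext {y z : Leavitt E K} (h : y.val = z.val) : y = z := Subtype.ext h

variable {E K} in
theorem Leavitt.val_mem (y : Leavitt E K) : y.val ∈ leavittSubalgebra E K := y.2

theorem gen_mem (g : E.Gen) : gen E K g ∈ leavittSubalgebra E K :=
  NonUnitalAlgebra.subset_adjoin K ⟨g, rfl⟩

variable {E}

/-- A vertex as an element of `L_K(E)`. -/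
def lvertex (a : E.Vertex) : Leavitt E K := ⟨gen E K (Gen.vertex a), gen_mem E K _⟩

/-- An edge as an element of `L_K(E)`. -/
def ledge (f : E.Edge) : Leavitt E K := ⟨gen E K (Gen.edge f), gen_mem E K _⟩

/-- A ghost edge as an element of `L_K(E)`. -/
def lghost (f : E.Edge) : Leavitt E K := ⟨gen E K (Gen.ghost f), gen_mem E K _⟩

/-- The product `e₁ e₂ ⋯ e_{k+1}` in `L_K(E)` of the first `k + 1` edges of `e^∞`. -/
def ClosedPath.initialProduct (e : E.ClosedPath) : ℕ → Leavitt E K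
  | 0 => ledge K (e.inf.edge 0)
  | k + 1 => ClosedPath.initialProduct e k * ledge K (e.inf.edge (k + 1))

/-- The closed path `e = e₁ ⋯ e_N` as an element of `L_K(E)`. -/
def ClosedPath.elem (e : E.ClosedPath) : Leavitt E K := e.initialProduct K e.n

/-- Homomorphisms out of the unital algebra, from images of the generators that satisfy the
relations. -/
def liftGen {B : Type x} [Ring B] [Algebra K B] (φ : E.Gen → B)
    (h : ∀ ⦃p q⦄, Rel E K p q → FreeAlgebra.lift K φ p = FreeAlgebra.lift K φ q) :
    LeavittUnitization E K →ₐ[K] B :=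
  RingQuot.liftAlgHom K ⟨FreeAlgebra.lift K φ, h⟩

theorem liftGen_gen {B : Type x} [Ring B] [Algebra K B] (φ : E.Gen → B)
    (h : ∀ ⦃p q⦄, Rel E K p q → FreeAlgebra.lift K φ p = FreeAlgebra.lift K φ q) (g : E.Gen) :
    liftGen K φ h (gen E K g) = φ g := by
  simp [liftGen, gen]

theorem gen_rel {p q : FreeAlgebra K E.Gen} (h : Rel E K p q) :
    RingQuot.mkAlgHom K (Rel E K) p = RingQuot.mkAlgHom K (Rel E K) q :=
  RingQuot.mkAlgHom_rel K h

theorem ext_gen {B : Type x} [Ring B] [Algebra K B] {φ ψ : LeavittUnitization E K →ₐ[K] B}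
    (h : ∀ g, φ (gen E K g) = ψ (gen E K g)) : φ = ψ := by
  apply RingQuot.ringQuot_ext'
  apply FreeAlgebra.hom_ext
  funext g
  exact h g

theorem lift_gen_eq (p : FreeAlgebra K E.Gen) :
    FreeAlgebra.lift K (gen E K) p = RingQuot.mkAlgHom K (Rel E K) p := by
  have : FreeAlgebra.lift K (gen E K) = RingQuot.mkAlgHom K (Rel E K) := by
    apply FreeAlgebra.hom_ext
    funext g
    simp [gen]
  rw [this]

theorem vertex_mul_self (a : E.Vertex) : lvertex K a * lvertex K a = lvertex K a := by
  have h := gen_rel K (Rel.vertex_mul_self a)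
  rw [map_mul] at h
  exact Leavitt.ext h

theorem source_mul_edge (f : E.Edge) : lvertex K (E.s f) * ledge K f = ledge K f := by
  have h := gen_rel K (Rel.source_mul_edge f)
  rw [map_mul] at h
  exact Leavitt.ext h

theorem edge_mul_range (f : E.Edge) : ledge K f * lvertex K (E.r f) = ledge K f := by
  have h := gen_rel K (Rel.edge_mul_range f)
  rw [map_mul] at h
  exact Leavitt.ext h

theorem range_mul_ghost (f : E.Edge) : lvertex K (E.r f) * lghost K f = lghost K f := by
  have h := gen_rel K (Rel.range_mul_ghost f)
  rw [map_mul] at h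
  exact Leavitt.ext h

theorem ClosedPath.initialProduct_mul (e : E.ClosedPath) (k : ℕ) :
    e.initialProduct K k * lvertex K (E.s (e.inf.edge (k + 1))) = e.initialProduct K k := by
  rw [← e.inf.chain]
  cases k with
  | zero => exact edge_mul_range K _
  | succ k => simp only [ClosedPath.initialProduct, mul_assoc, edge_mul_range]

theorem ClosedPath.elem_mul_base (e : E.ClosedPath) :
    e.elem K * lvertex K e.base = e.elem K := by
  have h := e.initialProduct_mul K e.n
  have h2 : e.inf.edge (e.n + 1) = e.edge 0 := by
    have := e.inf_add_period 0
    rw [Nat.zero_add] at this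
    rw [this]
    simp [ClosedPath.inf]
  rw [h2] at h
  exact h

/-- The scalar by which the gauge automorphism multiplies a generator. -/
noncomputable def gaugeScalar (f : E.Edge) (a : Kˣ) : E.Gen → K := by
  classical
  exact fun
    | Gen.vertex _ => 1
    | Gen.edge g => if g = f then (a : K) else 1
    | Gen.ghost g => if g = f then ((a⁻¹ : Kˣ) : K) else 1

theorem gaugeScalar_mul (f g : E.Edge) (a : Kˣ) :
    gaugeScalar K f a (Gen.ghost g) * gaugeScalar K f a (Gen.edge g) = 1 := by
  by_cases h : g = f <;> simp [gaugeScalar, h]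

/-- The endomorphism of the unital algebra that fixes the vertices and all edges and ghost edges
except `f ↦ a f` and `f* ↦ a⁻¹ f*`. -/
noncomputable def gaugeHom (f : E.Edge) (a : Kˣ) :
    LeavittUnitization E K →ₐ[K] LeavittUnitization E K :=
  liftGen K (fun g => gaugeScalar K f a g • gen E K g) (by
    classical
    intro p q h
    have hv : ∀ b, gaugeScalar K f a (Gen.vertex b) = 1 := fun _ => rfl
    cases h with
    | vertex_mul_self b =>
      have := gen_rel K (Rel.vertex_mul_self (K := K) b)
      simp only [map_mul, FreeAlgebra.lift_ι_apply, hv, one_smul] at this ⊢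
      exact this
    | vertex_mul_vertex b c hbc =>
      have := gen_rel K (Rel.vertex_mul_vertex (K := K) b c hbc)
      simp only [map_mul, FreeAlgebra.lift_ι_apply, hv, one_smul, map_zero] at this ⊢
      exact this
    | source_mul_edge g =>
      have := gen_rel K (Rel.source_mul_edge (K := K) g)
      simp only [map_mul, FreeAlgebra.lift_ι_apply, hv, one_smul, mul_smul_comm] at this ⊢
      exact congrArg _ this
    | edge_mul_range g =>
      have := gen_rel K (Rel.edge_mul_range (K := K) g)
      simp only [map_mul, FreeAlgebra.lift_ι_apply, hv, one_smul, smul_mul_assoc] at this ⊢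
      exact congrArg _ this
    | range_mul_ghost g =>
      have := gen_rel K (Rel.range_mul_ghost (K := K) g)
      simp only [map_mul, FreeAlgebra.lift_ι_apply, hv, one_smul, mul_smul_comm] at this ⊢
      exact congrArg _ this
    | ghost_mul_source g =>
      have := gen_rel K (Rel.ghost_mul_source (K := K) g)
      simp only [map_mul, FreeAlgebra.lift_ι_apply, hv, one_smul, smul_mul_assoc] at this ⊢
      exact congrArg _ this
    | ck1 g g' =>
      have := gen_rel K (Rel.ck1 (K := K) g g')
      by_cases hg : g = g'
      · subst hg
        simp only [map_mul, FreeAlgebra.lift_ι_apply, hv, one_smul, if_true,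
          smul_mul_smul_comm, gaugeScalar_mul] at this ⊢
        exact this
      · simp only [map_mul, FreeAlgebra.lift_ι_apply, hg, if_false, map_zero,
          smul_mul_smul_comm] at this ⊢
        exact (congrArg _ this).trans (smul_zero _)
    | ck2 b hfin hne =>
      have := gen_rel K (Rel.ck2 (K := K) b hfin hne)
      simp only [map_mul, map_sum, FreeAlgebra.lift_ι_apply, hv, one_smul,
        smul_mul_smul_comm] at this ⊢
      refine Eq.trans this (Finset.sum_congr rfl fun g _ => ?_)
      rw [mul_comm, gaugeScalar_mul, one_smul]
      rfl)

theorem gaugeHom_gen (f : E.Edge) (a : Kˣ) (g : E.Gen) :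
    gaugeHom K f a (gen E K g) = gaugeScalar K f a g • gen E K g :=
  liftGen_gen K _ _ g

theorem gaugeHom_gaugeHom_inv (f : E.Edge) (a : Kˣ) (y : LeavittUnitization E K) :
    gaugeHom K f a (gaugeHom K f a⁻¹ y) = y := by
  have : (gaugeHom K f a).comp (gaugeHom K f a⁻¹) = AlgHom.id K _ := by
    apply ext_gen
    intro g
    simp only [AlgHom.comp_apply, gaugeHom_gen, map_smul, smul_smul, AlgHom.id_apply]
    cases g with
    | vertex b => simp [gaugeScalar]
    | edge g => by_cases h : g = f <;> simp [gaugeScalar, h]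
    | ghost g => by_cases h : g = f <;> simp [gaugeScalar, h]
  exact DFunLike.congr_fun this y

theorem gaugeHom_mem (f : E.Edge) (a : Kˣ) {y : LeavittUnitization E K}
    (hy : y ∈ leavittSubalgebra E K) : gaugeHom K f a y ∈ leavittSubalgebra E K := by
  induction hy using NonUnitalAlgebra.adjoin_induction with
  | mem y hy =>
    obtain ⟨g, rfl⟩ := hy
    rw [gaugeHom_gen]
    exact SMulMemClass.smul_mem _ (gen_mem E K g)
  | add y z _ _ hy hz => rw [map_add]; exact add_mem hy hz
  | zero => rw [map_zero]; exact zero_mem _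
  | mul y z _ _ hy hz => rw [map_mul]; exact mul_mem hy hz
  | smul k y _ hy => rw [map_smul]; exact SMulMemClass.smul_mem _ hy

/-- The automorphism of `L_K(E)` that fixes every vertex and all edges and ghost edges
except `f ↦ a f` and `f* ↦ a⁻¹ f*`. -/
noncomputable def gaugeAut (f : E.Edge) (a : Kˣ) : Leavitt E K ≃+* Leavitt E K where
  toFun y := ⟨gaugeHom K f a y.val, gaugeHom_mem K f a y.val_mem⟩
  invFun y := ⟨gaugeHom K f a⁻¹ y.val, gaugeHom_mem K f a⁻¹ y.val_mem⟩
  left_inv y := by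
    have h := gaugeHom_gaugeHom_inv K f a⁻¹ y.val
    rw [inv_inv] at h
    exact Leavitt.ext h
  right_inv y := Leavitt.ext (gaugeHom_gaugeHom_inv K f a y.val)
  map_mul' y z := Leavitt.ext (map_mul (gaugeHom K f a) y.val z.val)
  map_add' y z := Leavitt.ext (map_add (gaugeHom K f a) y.val z.val)

end Leavitt

end DirGraph

/-- A unital left module over a possibly non-unital ring `A`: an abelian group with an action
of `A` obeying the usual laws and such that `A M = M`, that is, every element is a finite sum of
elements `a • m`. -/
class UnitalModule (A : Type u) (M : Type v) [NonUnitalRing A] [AddCommGroup M]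
    extends SMul A M where
  smul_add : ∀ (a : A) (m n : M), a • (m + n) = a • m + a • n
  add_smul : ∀ (a b : A) (m : M), (a + b) • m = a • m + b • m
  mul_smul : ∀ (a b : A) (m : M), (a * b) • m = a • (b • m)
  mem_closure : ∀ m : M, m ∈ AddSubgroup.closure {y : M | ∃ (a : A) (n : M), y = a • n}

/-- Homomorphisms of left `A`-modules. -/
structure UnitalModule.Hom (A : Type u) (M : Type v) (N : Type w) [NonUnitalRing A]
    [AddCommGroup M] [AddCommGroup N] [UnitalModule A M] [UnitalModule A N] extends M →+ N where
  map_smul : ∀ (a : A) (m : M), toFun (a • m) = a • toFun m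

namespace UnitalModule

instance (A : Type u) (M : Type v) (N : Type w) [NonUnitalRing A]
    [AddCommGroup M] [AddCommGroup N] [UnitalModule A M] [UnitalModule A N] :
    CoeFun (Hom A M N) (fun _ => M → N) := ⟨fun f => f.toAddMonoidHom⟩

/-- `M` is finitely generated: some finite subset of `M` lies in no proper submodule. -/
def IsFinGen (A : Type u) (M : Type v) [NonUnitalRing A] [AddCommGroup M]
    [UnitalModule A M] : Prop :=
  ∃ S : Set M, S.Finite ∧
    ∀ U : AddSubgroup M, (∀ (a : A) (m : M), m ∈ U → a • m ∈ U) → S ⊆ U → U = ⊤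

/-- `P` is projective as a unital module: homomorphisms from `P` lift along surjective homomorphisms
of unital modules (here with underlying sets in an arbitrary universe `x`). -/
def IsProjective (A : Type u) (P : Type v) [NonUnitalRing A] [AddCommGroup P]
    [UnitalModule A P] : Prop :=
  ∀ (M N : Type x) [AddCommGroup M] [AddCommGroup N] [UnitalModule A M] [UnitalModule A N]
    (g : Hom A M N) (f : Hom A P N), Function.Surjective g →
    ∃ h : Hom A P M, ∀ p, g (h p) = f p

/-- `M` is finitely presented: there is an exact sequence `P₁ → P₀ → M → 0` of unital modules
with `P₁` and `P₀` finitely generated and projective. -/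
def IsFinPres (A : Type u) (M : Type v) [NonUnitalRing A] [AddCommGroup M]
    [UnitalModule A M] : Prop :=
  ∃ (P₁ P₀ : Type (max u v)) (_ : AddCommGroup P₁) (_ : AddCommGroup P₀)
    (_ : UnitalModule A P₁) (_ : UnitalModule A P₀) (d : Hom A P₁ P₀) (π : Hom A P₀ M),
    IsFinGen A P₁ ∧ IsProjective.{u, max u v, max u v} A P₁ ∧
    IsFinGen A P₀ ∧ IsProjective.{u, max u v, max u v} A P₀ ∧
    Function.Exact d π ∧ Function.Surjective π

/-- The twisted module `M^σ`: the abelian group `M` with the action `l ⋆ m = σ(l) m`. -/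
def Twist {A : Type u} [NonUnitalRing A] (_σ : A ≃+* A) (M : Type v) : Type v := M

/-- The identity map from `M` to `M^σ`. -/
def toTwist {A : Type u} [NonUnitalRing A] (σ : A ≃+* A) {M : Type v} (m : M) : Twist σ M := m

/-- The identity map from `M^σ` to `M`. -/
def ofTwist {A : Type u} [NonUnitalRing A] (σ : A ≃+* A) {M : Type v} (m : Twist σ M) : M := m

instance {A : Type u} [NonUnitalRing A] (σ : A ≃+* A) (M : Type v) [h : AddCommGroup M] :
    AddCommGroup (Twist σ M) := h

instance {A : Type u} [NonUnitalRing A] (σ : A ≃+* A) (M : Type v) [AddCommGroup M]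
    [UnitalModule A M] : UnitalModule A (Twist σ M) where
  smul a m := toTwist σ (σ a • ofTwist σ m)
  smul_add a m n := UnitalModule.smul_add (σ a) (ofTwist σ m) (ofTwist σ n)
  add_smul a b m := by
    change σ (a + b) • ofTwist σ m = σ a • ofTwist σ m + σ b • ofTwist σ m
    rw [map_add, UnitalModule.add_smul]
  mul_smul a b m := by
    change σ (a * b) • ofTwist σ m = σ a • σ b • ofTwist σ m
    rw [map_mul, UnitalModule.mul_smul]
  mem_closure m := by
    refine AddSubgroup.closure_mono ?_ (UnitalModule.mem_closure (A := A) (ofTwist σ m))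
    rintro y ⟨a, n, rfl⟩
    refine ⟨σ.symm a, toTwist σ n, ?_⟩
    change a • n = σ (σ.symm a) • n
    rw [RingEquiv.apply_symm_apply]

end UnitalModule

namespace DirGraph

section LeftIdeal

variable {E : DirGraph.{u, v}} {K : Type w} [Field K]

/-- The left ideal `L_K(E) y = {l y | l ∈ L_K(E)}`. -/
def leftIdeal (y : Leavitt E K) : AddSubgroup (Leavitt E K) := (AddMonoidHom.mulRight y).range

theorem leavitt_idempotent (l : Leavitt E K) :
    l ∈ AddSubgroup.closure {z : Leavitt E K | ∃ p q : Leavitt E K, z = p * q} := by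
  obtain ⟨l, hl⟩ := l
  induction hl using NonUnitalAlgebra.adjoin_induction with
  | mem y hy =>
    obtain ⟨g, rfl⟩ := hy
    apply AddSubgroup.subset_closure
    cases g with
    | vertex a => exact ⟨_, _, (vertex_mul_self K a).symm⟩
    | edge f => exact ⟨_, _, (source_mul_edge K f).symm⟩
    | ghost f => exact ⟨_, _, (range_mul_ghost K f).symm⟩
  | add y z _ _ hy hz => exact add_mem hy hz
  | zero => exact zero_mem _
  | mul y z hy hz _ _ => exact AddSubgroup.subset_closure ⟨⟨y, hy⟩, ⟨z, hz⟩, rfl⟩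
  | smul k y hy ih =>
    have key : ∀ z : Leavitt E K,
        z ∈ AddSubgroup.closure {z : Leavitt E K | ∃ p q : Leavitt E K, z = p * q} →
        k • z ∈ AddSubgroup.closure {z : Leavitt E K | ∃ p q : Leavitt E K, z = p * q} := by
      intro z hz
      induction hz using AddSubgroup.closure_induction with
      | mem z hz =>
        obtain ⟨p, q, rfl⟩ := hz
        exact AddSubgroup.subset_closure ⟨k • p, q, (smul_mul_assoc k p q).symm⟩
      | zero => rw [smul_zero]; exact zero_mem _
      | add y z _ _ hy hz => rw [smul_add]; exact add_mem hy hz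
      | neg y _ hy => rw [smul_neg]; exact neg_mem hy
    exact key _ ih

/-- `L_K(E)` acts on `L_K(E) y` by left multiplication. -/
instance leftIdealSMul (y : Leavitt E K) : SMul (Leavitt E K) (leftIdeal y) where
  smul l z := ⟨l * z, by
    obtain ⟨p, hp⟩ := z.2
    refine ⟨l * p, ?_⟩
    rw [← hp]
    exact mul_assoc l p y⟩

/-- `L_K(E) y` is a unital left `L_K(E)`-module under multiplication. -/
instance leftIdealModule (y : Leavitt E K) : UnitalModule (Leavitt E K) (leftIdeal y) where
  smul_add l z t := Subtype.ext (mul_add l z.1 t.1)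
  add_smul l l' z := Subtype.ext (add_mul l l' z.1)
  mul_smul l l' z := Subtype.ext (mul_assoc l l' z.1)
  mem_closure := by
    intro z
    obtain ⟨p, rfl⟩ := (AddMonoidHom.mulRight y).rangeRestrict_surjective z
    have h := AddSubgroup.mem_map_of_mem (AddMonoidHom.mulRight y).rangeRestrict
      (leavitt_idempotent p)
    rw [AddMonoidHom.map_closure] at h
    refine AddSubgroup.closure_mono ?_ h
    rintro _ ⟨_, ⟨b, c, rfl⟩, rfl⟩
    exact ⟨b, (AddMonoidHom.mulRight y).rangeRestrict c, Subtype.ext (mul_assoc b c y)⟩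

end LeftIdeal

section Chen

variable {E : DirGraph.{u, v}} (K : Type w) [Field K] (e : E.ClosedPath)

/-- The set `[e^∞]` of the infinite paths that are tail equivalent to `e^∞`. -/
abbrev TailClass : Type v := {p : E.InfPath // InfPath.IsTailOf e p}

/-- The `K`-vector space `V_{[e^∞]}` with basis `[e^∞]`. -/
def ChenModule : Type (max v w) := TailClass e →₀ K

noncomputable instance : AddCommGroup (ChenModule K e) :=
  inferInstanceAs (AddCommGroup (TailClass e →₀ K))

noncomputable instance : Module K (ChenModule K e) :=
  inferInstanceAs (Module K (TailClass e →₀ K))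

variable {e} in
/-- An infinite path in `[e^∞]` as a basis vector of `V_{[e^∞]}`. -/
noncomputable def chenBasis (q : TailClass e) : ChenModule K e := Finsupp.single q (1 : K)

/-- The linear map given on the basis `[e^∞]`. -/
noncomputable def chenLift (φ : TailClass e → ChenModule K e) : Module.End K (ChenModule K e) :=
  Finsupp.linearCombination K φ

variable {K e} in
theorem chenLift_basis (φ : TailClass e → ChenModule K e) (q : TailClass e) :
    chenLift K e φ (chenBasis K q) = φ q := by
  simp only [chenLift, chenBasis]
  exact (Finsupp.linearCombination_single K 1 q).trans (one_smul _ _)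

variable {K e} in
theorem chen_ext {φ ψ : Module.End K (ChenModule K e)}
    (h : ∀ q, φ (chenBasis K q) = ψ (chenBasis K q)) : φ = ψ := by
  refine Finsupp.lhom_ext' (M := K) (N := ChenModule K e) fun q => ?_
  exact LinearMap.ext_ring (h q)

open Classical in
/-- The action of the generators on `V_{[e^∞]}`: a vertex `a` fixes the paths that start at `a` and
kills the others; an edge `f` sends `q` to `f q` if `f` ends where `q` starts and to zero
otherwise; `f*` removes the first edge of `q` if it is `f`, and kills `q` otherwise. -/
noncomputable def chenOp : E.Gen → Module.End K (ChenModule K e)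
  | Gen.vertex a => chenLift K e fun q => if q.1.source = a then chenBasis K q else 0
  | Gen.edge f => chenLift K e fun q =>
      if h : E.r f = q.1.source then chenBasis K ⟨q.1.cons f h, q.2.cons f h⟩ else 0
  | Gen.ghost f => chenLift K e fun q =>
      if q.1.edge 0 = f then chenBasis K ⟨q.1.tail, q.2.tail⟩ else 0

open Classical in
theorem chenOp_vertex (a : E.Vertex) (q : TailClass e) :
    chenOp K e (Gen.vertex a) (chenBasis K q) = if q.1.source = a then chenBasis K q else 0 :=
  chenLift_basis _ q

open Classical in
theorem chenOp_edge (f : E.Edge) (q : TailClass e) :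
    chenOp K e (Gen.edge f) (chenBasis K q) =
      if h : E.r f = q.1.source then chenBasis K ⟨q.1.cons f h, q.2.cons f h⟩ else 0 :=
  chenLift_basis _ q

open Classical in
theorem chenOp_ghost (f : E.Edge) (q : TailClass e) :
    chenOp K e (Gen.ghost f) (chenBasis K q) =
      if q.1.edge 0 = f then chenBasis K ⟨q.1.tail, q.2.tail⟩ else 0 :=
  chenLift_basis _ q

theorem edge_ghost_basis (q : TailClass e) :
    chenOp K e (Gen.edge (q.1.edge 0)) (chenOp K e (Gen.ghost (q.1.edge 0)) (chenBasis K q))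
      = chenBasis K q := by
  have h : E.r (q.1.edge 0) = q.1.tail.source := q.1.chain 0
  rw [chenOp_ghost, if_pos rfl, chenOp_edge, dif_pos h]
  congr 1
  apply Subtype.ext
  obtain ⟨⟨p, hp⟩, hq⟩ := q
  simp only [InfPath.cons, InfPath.tail, InfPath.mk.injEq]
  funext i
  cases i <;> rfl

/-- `V_{[e^∞]}` as a representation. -/
noncomputable def chenRep : LeavittUnitization E K →ₐ[K] Module.End K (ChenModule K e) :=
  liftGen K (chenOp K e) (by
    classical
    intro p q h
    apply chen_ext
    intro t
    cases h with
    | vertex_mul_self b =>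
      simp only [map_mul, FreeAlgebra.lift_ι_apply, Module.End.mul_apply, chenOp_vertex]
      by_cases h : t.1.source = b <;> simp [h, chenOp_vertex]
    | vertex_mul_vertex b c hbc =>
      simp only [map_mul, FreeAlgebra.lift_ι_apply, Module.End.mul_apply, chenOp_vertex, map_zero,
        LinearMap.zero_apply]
      by_cases h : t.1.source = c
      · rw [if_pos h, chenOp_vertex, if_neg (fun h' => hbc (h'.symm.trans h))]
      · rw [if_neg h, map_zero]
    | source_mul_edge g =>
      simp only [map_mul, FreeAlgebra.lift_ι_apply, Module.End.mul_apply, chenOp_edge]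
      by_cases h : E.r g = t.1.source
      · rw [dif_pos h, chenOp_vertex]
        exact if_pos rfl
      · rw [dif_neg h, map_zero]
    | edge_mul_range g =>
      simp only [map_mul, FreeAlgebra.lift_ι_apply, Module.End.mul_apply, chenOp_vertex]
      by_cases h : t.1.source = E.r g
      · rw [if_pos h]
      · rw [if_neg h, map_zero, chenOp_edge, dif_neg (fun h' => h h'.symm)]
    | range_mul_ghost g =>
      simp only [map_mul, FreeAlgebra.lift_ι_apply, Module.End.mul_apply, chenOp_ghost]
      by_cases h : t.1.edge 0 = g
      · rw [if_pos h, chenOp_vertex, if_pos]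
        rw [← h]
        exact (t.1.chain 0).symm
      · rw [if_neg h, map_zero]
    | ghost_mul_source g =>
      simp only [map_mul, FreeAlgebra.lift_ι_apply, Module.End.mul_apply, chenOp_vertex]
      by_cases h : t.1.source = E.s g
      · rw [if_pos h]
      · rw [if_neg h, map_zero, chenOp_ghost, if_neg]
        intro h'
        exact h (congrArg E.s h')
    | ck1 g g' =>
      simp only [map_mul, FreeAlgebra.lift_ι_apply, Module.End.mul_apply, chenOp_edge]
      by_cases hg : g = g'
      · subst hg
        rw [if_pos rfl, FreeAlgebra.lift_ι_apply, chenOp_vertex]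
        by_cases h : E.r g = t.1.source
        · rw [dif_pos h, if_pos h.symm, chenOp_ghost]
          exact if_pos rfl
        · rw [dif_neg h, if_neg (fun h' => h h'.symm), map_zero]
      · rw [if_neg hg, map_zero, LinearMap.zero_apply]
        by_cases h : E.r g' = t.1.source
        · rw [dif_pos h, chenOp_ghost]
          exact if_neg (fun h' => hg h'.symm)
        · rw [dif_neg h, map_zero]
    | ck2 b hfin hne =>
      simp only [map_mul, map_sum, FreeAlgebra.lift_ι_apply, LinearMap.sum_apply,
        Module.End.mul_apply, chenOp_vertex]
      have hne : ∀ g, g ≠ t.1.edge 0 →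
          chenOp K e (Gen.edge g) (chenOp K e (Gen.ghost g) (chenBasis K t)) = 0 := by
        intro g hg
        rw [chenOp_ghost, if_neg (fun h' => hg h'.symm), map_zero]
      by_cases h : t.1.source = b
      · rw [if_pos h, Finset.sum_eq_single (t.1.edge 0) (fun g _ hg => hne g hg)]
        · rw [edge_ghost_basis]
        · intro h'
          exact absurd (hfin.mem_toFinset.2 h) h'
      · rw [if_neg h]
        refine (Finset.sum_eq_zero fun g hg => hne g ?_).symm
        rintro rfl
        exact h (hfin.mem_toFinset.1 hg))

theorem chenRep_gen (g : E.Gen) : chenRep K e (gen E K g) = chenOp K e g := liftGen_gen K _ _ g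

/-- `V_{[e^∞]}` is a unital left `L_K(E)`-module. -/
noncomputable instance chenModuleModule : UnitalModule (Leavitt E K) (ChenModule K e) where
  smul l m := chenRep K e l.val m
  smul_add l m n := map_add (chenRep K e l.val) m n
  add_smul l l' m := by
    change chenRep K e (l + l').val m = _
    rw [map_add, map_add]
    rfl
  mul_smul l l' m := by
    change chenRep K e (l * l').val m = _
    rw [map_mul, map_mul]
    rfl
  mem_closure m := by
    refine Finsupp.induction_linear (motive := fun m : TailClass e →₀ K =>
      (show ChenModule K e from m) ∈ AddSubgroup.closure
        {y : ChenModule K e | ∃ (l : Leavitt E K) (n : ChenModule K e), y = chenRep K e l.val n})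
      m (zero_mem _) (fun _ _ h h' => add_mem h h') ?_
    intro q k
    apply AddSubgroup.subset_closure
    refine ⟨lvertex K q.1.source, k • chenBasis K q, ?_⟩
    rw [map_smul]
    change _ = k • chenRep K e (gen E K (Gen.vertex q.1.source)) (chenBasis K q)
    rw [chenRep_gen, chenOp_vertex, if_pos rfl]
    exact (Finsupp.smul_single_one q k).symm

/-- The basis vector `e^∞` of `V_{[e^∞]}`. -/
noncomputable def chenInf : ChenModule K e := chenBasis K ⟨e.inf, InfPath.isTailOf_inf e⟩

/-- The gauge automorphism `σ_{e,a}`, which depends only on `a` and on the first edge of `e`. -/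
noncomputable def gauge (a : Kˣ) : Leavitt E K ≃+* Leavitt E K := gaugeAut K (e.edge 0) a

/-- The twisted Chen module `V_{[e^∞]}^{σ_{e,a}}`. -/
abbrev TwistedChen (a : Kˣ) : Type (max v w) := UnitalModule.Twist (gauge K e a) (ChenModule K e)

/-- The element `a⁻¹ e - s(e)` of `L_K(E)`. -/
noncomputable def relator (a : Kˣ) : Leavitt E K :=
  (a : K)⁻¹ • e.elem K - lvertex K e.base

theorem relator_mul_base (a : Kˣ) : relator K e a * lvertex K e.base = relator K e a := by
  rw [relator, sub_mul, smul_mul_assoc, ClosedPath.elem_mul_base K e, vertex_mul_self]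

/-- The inclusion `ι : L_K(E)(a⁻¹ e - s(e)) → L_K(E) s(e)`. -/
noncomputable def resIncl (a : Kˣ) :
    UnitalModule.Hom (Leavitt E K) (leftIdeal (relator K e a)) (leftIdeal (lvertex K e.base)) where
  toFun y := ⟨y.1, by
    obtain ⟨p, hp⟩ := y.2
    refine ⟨p * relator K e a, ?_⟩
    rw [← hp]
    change p * relator K e a * lvertex K e.base = p * relator K e a
    rw [mul_assoc, relator_mul_base]⟩
  map_zero' := rfl
  map_add' _ _ := rfl
  map_smul _ _ := rfl

/-- The map `ρ_{e^∞} ∘ σ_{e,a} : L_K(E) s(e) → V_{[e^∞]}^{σ_{e,a}}`, `y ↦ σ_{e,a}(y) e^∞`. -/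
noncomputable def resProj (a : Kˣ) :
    UnitalModule.Hom (Leavitt E K) (leftIdeal (lvertex K e.base)) (TwistedChen K e a) where
  toFun y := UnitalModule.toTwist (gauge K e a) (gauge K e a y.1 • chenInf K e)
  map_zero' := by
    have h : gauge K e a ((0 : leftIdeal (lvertex K e.base)) : Leavitt E K) = 0 := map_zero _
    rw [h]
    change chenRep K e (0 : Leavitt E K).val (chenInf K e) = 0
    rw [map_zero, map_zero]
    rfl
  map_add' y z := by
    have h : gauge K e a ((y + z : leftIdeal (lvertex K e.base)) : Leavitt E K)
        = gauge K e a y.1 + gauge K e a z.1 := map_add _ _ _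
    rw [h, UnitalModule.add_smul]
    rfl
  map_smul l y := by
    have h : gauge K e a ((l • y : leftIdeal (lvertex K e.base)) : Leavitt E K)
        = gauge K e a l * gauge K e a y.1 := map_mul _ _ _
    rw [h, UnitalModule.mul_smul]
    rfl

end Chen

end DirGraph

/-!
The proof rests on two facts about a simple closed path `e` with base `v = s(e)`.

*Right multiplication by `a⁻¹ e - v` is injective on `L_K(E) v`.* The Leavitt path algebra is
`ℤ`-graded (`gradingHom`), and `y (a⁻¹ e - v) = 0` says that `y e = a y`. The lowest homogeneous
component of the right side has smaller degree than every component of the left side, so `y = 0`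
(`eq_zero_of_mul_elem`). Hence `L_K(E)(a⁻¹ e - v)` is isomorphic to `L_K(E) v`, and both are
projective because `v` is idempotent (`isProjective_leftIdeal`).

*The annihilator of `e^∞` in `L_K(E) v` is `L_K(E)(e - v)`.* The assignment that sends a basis
vector `lam e^∞` to the class of `lam` in `L_K(E) / L_K(E)(e - v)` is well defined: as `e` is
simple, two choices of `lam` differ by a power of `e`, which acts as `v` on the quotient
(`InfPath.initial_sub_mem`). It is `L_K(E)`-linear (`chenToQuotient_smul`), so it sends `y e^∞` to
the class of `y` for every `y` in `L_K(E) v`; if `y e^∞ = 0`, then `y` lies in `L_K(E)(e - v)`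
(`mem_leftIdeal_of_smul_chenInf`). No normal form for the elements of `L_K(E)` is needed.

The gauge automorphism maps `a⁻¹ e - v` to `e - v`, because the first edge of `e` occurs in `e` only
once (`gauge_relator`). This carries the second fact over to the twisted module. Surjectivity holds
since `lam` sends `e^∞` to `lam e^∞` (`initial_smul`).
-/

namespace DirGraph

/-! ### The grading of the Leavitt path algebra -/

section Grading

variable {E : DirGraph.{u, v}} (K : Type w) [Field K]

/-- The degree of a generator: vertices have degree `0`, edges `1` and ghost edges `-1`. -/
def Gen.degree : E.Gen → ℤ
  | Gen.vertex _ => 0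
  | Gen.edge _ => 1
  | Gen.ghost _ => -1

/-- The `ℤ`-grading of the unitization of `L_K(E)`, encoded as the algebra homomorphism to the
Laurent polynomials that sends a homogeneous element `y` of degree `d` to `y T^d`. -/
noncomputable def gradingHom :
    LeavittUnitization E K →ₐ[K] AddMonoidAlgebra (LeavittUnitization E K) ℤ :=
  liftGen K (fun g => AddMonoidAlgebra.single g.degree (gen E K g)) (by
    classical
    intro p q h
    cases h with
    | vertex_mul_self b =>
      have := gen_rel K (Rel.vertex_mul_self (K := K) b)
      simp only [map_mul, FreeAlgebra.lift_ι_apply, AddMonoidAlgebra.single_mul_single]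
      exact congrArg (AddMonoidAlgebra.single (0 : ℤ)) ((map_mul _ _ _).symm.trans this)
    | vertex_mul_vertex b c hbc =>
      have := gen_rel K (Rel.vertex_mul_vertex (K := K) b c hbc)
      simp only [map_mul, FreeAlgebra.lift_ι_apply, AddMonoidAlgebra.single_mul_single, map_zero]
        at this ⊢
      exact (congrArg (AddMonoidAlgebra.single (0 : ℤ)) this).trans
        (AddMonoidAlgebra.single_zero _)
    | source_mul_edge g =>
      have := gen_rel K (Rel.source_mul_edge (K := K) g)
      simp only [map_mul, FreeAlgebra.lift_ι_apply, AddMonoidAlgebra.single_mul_single]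
      exact congrArg (AddMonoidAlgebra.single (1 : ℤ)) ((map_mul _ _ _).symm.trans this)
    | edge_mul_range g =>
      have := gen_rel K (Rel.edge_mul_range (K := K) g)
      simp only [map_mul, FreeAlgebra.lift_ι_apply, AddMonoidAlgebra.single_mul_single]
      exact congrArg (AddMonoidAlgebra.single (1 : ℤ)) ((map_mul _ _ _).symm.trans this)
    | range_mul_ghost g =>
      have := gen_rel K (Rel.range_mul_ghost (K := K) g)
      simp only [map_mul, FreeAlgebra.lift_ι_apply, AddMonoidAlgebra.single_mul_single]
      exact congrArg (AddMonoidAlgebra.single (-1 : ℤ)) ((map_mul _ _ _).symm.trans this)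
    | ghost_mul_source g =>
      have := gen_rel K (Rel.ghost_mul_source (K := K) g)
      simp only [map_mul, FreeAlgebra.lift_ι_apply, AddMonoidAlgebra.single_mul_single]
      exact congrArg (AddMonoidAlgebra.single (-1 : ℤ)) ((map_mul _ _ _).symm.trans this)
    | ck1 g g' =>
      have := gen_rel K (Rel.ck1 (K := K) g g')
      by_cases hg : g = g'
      · subst hg
        simp only [map_mul, FreeAlgebra.lift_ι_apply, AddMonoidAlgebra.single_mul_single,
          if_true] at this ⊢
        exact congrArg (AddMonoidAlgebra.single (0 : ℤ)) this
      · simp only [map_mul, FreeAlgebra.lift_ι_apply, AddMonoidAlgebra.single_mul_single, hg,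
          if_false, map_zero] at this ⊢
        exact (congrArg (AddMonoidAlgebra.single (0 : ℤ)) this).trans
          (AddMonoidAlgebra.single_zero _)
    | ck2 b hfin hne =>
      have := gen_rel K (Rel.ck2 (K := K) b hfin hne)
      simp only [map_mul, map_sum, FreeAlgebra.lift_ι_apply,
        AddMonoidAlgebra.single_mul_single] at this ⊢
      exact (congrArg (AddMonoidAlgebra.singleAddHom (0 : ℤ)) this).trans (map_sum _ _ _))

theorem gradingHom_gen (g : E.Gen) :
    gradingHom K (gen E K g) = AddMonoidAlgebra.single g.degree (gen E K g) :=
  liftGen_gen K _ _ g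

/-- Evaluation at `T = 1` is a left inverse of the grading homomorphism. -/
theorem gradingHom_injective : Function.Injective (gradingHom (E := E) K) := by
  have h : (AddMonoidAlgebra.liftNCAlgHom (AlgHom.id K (LeavittUnitization E K))
      (1 : Multiplicative ℤ →* LeavittUnitization E K)
      (fun _ _ => Commute.one_right _)).comp (gradingHom K) = AlgHom.id K _ := by
    apply ext_gen
    intro g
    rw [AlgHom.comp_apply, gradingHom_gen, AddMonoidAlgebra.coe_liftNCAlgHom,
      AddMonoidAlgebra.liftNC_single]
    simp
  intro y z hyz
  have hy := DFunLike.congr_fun h y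
  have hz := DFunLike.congr_fun h z
  rw [AlgHom.comp_apply] at hy hz
  rw [hyz] at hy
  exact hy.symm.trans hz

theorem gradingHom_initialProduct (e : E.ClosedPath) (k : ℕ) :
    gradingHom K (e.initialProduct K k).val =
      AddMonoidAlgebra.single ((k : ℤ) + 1) (e.initialProduct K k).val := by
  induction k with
  | zero => exact gradingHom_gen K _
  | succ k ih =>
    rw [ClosedPath.initialProduct, map_mul, map_mul, ih]
    have h : gradingHom K (ledge K (e.inf.edge (k + 1))).val =
        AddMonoidAlgebra.single 1 (ledge K (e.inf.edge (k + 1))).val := gradingHom_gen K _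
    rw [h, AddMonoidAlgebra.single_mul_single]
    push_cast
    rfl

/-- A closed path has no eigenvectors with nonzero eigenvalue in the regular representation: the
lowest homogeneous component of `a x` has smaller degree than every component of `x e`. -/
theorem eq_zero_of_mul_elem (e : E.ClosedPath) (a : Kˣ) (y : Leavitt E K)
    (h : y * e.elem K = (a : K) • y) : y = 0 := by
  apply Leavitt.ext
  rw [map_zero]
  apply gradingHom_injective K
  rw [map_zero]
  have hX : gradingHom K y.val * AddMonoidAlgebra.single ((e.n : ℤ) + 1) (e.elem K).val =
      (a : K) • gradingHom K y.val := by
    rw [← map_smul, ← map_smul, ← h, map_mul, map_mul, ClosedPath.elem,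
      gradingHom_initialProduct]
  generalize gradingHom K y.val = X at hX
  have hcoeff : ∀ d : ℤ,
      X.coeff (d - ((e.n : ℤ) + 1)) * (e.elem K).val = (a : K) • X.coeff d := by
    intro d
    have := congrArg (fun Y => AddMonoidAlgebra.coeff Y d) hX
    rwa [AddMonoidAlgebra.coeff_mul_single_apply, ← sub_eq_add_neg] at this
  by_contra hne
  have hsupp : X.coeff.support.Nonempty := by
    rw [Finsupp.support_nonempty_iff]
    intro h0
    exact hne (AddMonoidAlgebra.coeff_injective h0)
  have hmin : X.coeff (X.coeff.support.min' hsupp - ((e.n : ℤ) + 1)) = 0 := by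
    by_contra h0
    have := Finset.min'_le _ _ (Finsupp.mem_support_iff.2 h0)
    omega
  have h1 := hcoeff (X.coeff.support.min' hsupp)
  rw [hmin, zero_mul] at h1
  have h2 : X.coeff (X.coeff.support.min' hsupp) = 0 := by
    have := congrArg (fun z => ((a⁻¹ : Kˣ) : K) • z) h1.symm
    simpa [smul_smul] using this
  exact Finsupp.mem_support_iff.1 (Finset.min'_mem _ hsupp) h2

end Grading

/-! ### Projectivity and finite generation of left ideals -/

section LeftIdeal

variable {E : DirGraph.{u, v}} {K : Type w} [Field K]

/-- If `b` fixes `y` from the left and right multiplication by `y` is injective on `L_K(E) b`, then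
`L_K(E) y` is isomorphic to `L_K(E) b`, and its homomorphisms correspond to the
elements of the target that are fixed by `b`. Hence it is projective. -/
theorem isProjective_leftIdeal {b y : Leavitt E K} (hby : b * y = y)
    (hbb : b * b = b) (hinj : ∀ z, z * b = z → z * y = 0 → z = 0) :
    UnitalModule.IsProjective.{max u v w, max u v w, x} (Leavitt E K) (leftIdeal y) := by
  intro M N _ _ _ _ g f hg
  have hex : ∀ p : leftIdeal y, ∃ z, z * b = z ∧ z * y = p.1 := by
    rintro ⟨_, l, rfl⟩
    exact ⟨l * b, by rw [mul_assoc, hbb], by rw [mul_assoc, hby]; rfl⟩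
  choose c hcb hcy using hex
  have huniq : ∀ (p : leftIdeal y) (z : Leavitt E K), z * b = z → z * y = p.1 → c p = z := by
    intro p z hzb hzy
    rw [← sub_eq_zero]
    apply hinj
    · rw [sub_mul, hcb, hzb]
    · rw [sub_mul, hcy, hzy, sub_self]
  have hyb : y ∈ leftIdeal y := ⟨b, hby⟩
  obtain ⟨m, hm⟩ := hg (f ⟨y, hyb⟩)
  have hadd : ∀ p q, c (p + q) = c p + c q := fun p q =>
    huniq _ _ (by rw [add_mul, hcb, hcb]) (by rw [add_mul, hcy, hcy]; rfl)
  refine ⟨{ AddMonoidHom.mk' (fun p => c p • m) fun p q => by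
              rw [hadd, UnitalModule.add_smul] with
            map_smul := fun l p => ?_ }, fun p => ?_⟩
  · have : c (l • p) = l * c p :=
      huniq _ _ (by rw [mul_assoc, hcb]) (by rw [mul_assoc, hcy]; rfl)
    change c (l • p) • m = l • c p • m
    rw [this, UnitalModule.mul_smul]
  · change g (c p • m) = f p
    refine (g.map_smul (c p) m).trans ?_
    refine (congrArg (c p • ·) hm).trans ?_
    refine (f.map_smul (c p) ⟨y, hyb⟩).symm.trans ?_
    exact congrArg f (Subtype.ext (hcy p))

theorem isFinGen_leftIdeal {y : Leavitt E K} (hy : y ∈ leftIdeal y) :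
    UnitalModule.IsFinGen (Leavitt E K) (leftIdeal y) := by
  refine ⟨{⟨y, hy⟩}, Set.finite_singleton _, fun U hU hS => ?_⟩
  rw [eq_top_iff]
  rintro ⟨_, l, rfl⟩ -
  exact hU l _ (hS rfl)

variable (K) (e : E.ClosedPath)

theorem base_mul_initialProduct (k : ℕ) :
    lvertex K e.base * e.initialProduct K k = e.initialProduct K k := by
  induction k with
  | zero => exact source_mul_edge K _
  | succ k ih => rw [ClosedPath.initialProduct, ← mul_assoc, ih]

theorem base_mul_relator (a : Kˣ) : lvertex K e.base * relator K e a = relator K e a := by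
  rw [relator, mul_sub, mul_smul_comm, ClosedPath.elem, base_mul_initialProduct, vertex_mul_self]

theorem isProjective_leftIdeal_relator (a : Kˣ) :
    UnitalModule.IsProjective.{max u v w, max u v w, x} (Leavitt E K)
      (leftIdeal (relator K e a)) := by
  refine isProjective_leftIdeal (base_mul_relator K e a) (vertex_mul_self K _) fun z hz h => ?_
  refine eq_zero_of_mul_elem K e a z ?_
  rw [relator, mul_sub, hz, mul_smul_comm, sub_eq_zero] at h
  conv_rhs => rw [← h, smul_smul, mul_inv_cancel₀ a.ne_zero, one_smul]

theorem isProjective_leftIdeal_vertex (b : E.Vertex) :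
    UnitalModule.IsProjective.{max u v w, max u v w, x} (Leavitt E K)
      (leftIdeal (lvertex K b)) :=
  isProjective_leftIdeal (vertex_mul_self K b) (vertex_mul_self K b)
    fun _ hz h => hz.symm.trans h

end LeftIdeal

/-! ### Initial segments of infinite paths -/

section InitialSegment

variable {E : DirGraph.{u, v}} (K : Type w) [Field K]

/-- The product in `L_K(E)` of the first `m` edges of an infinite path; for `m = 0` it is the vertex
at which the path starts. -/
def InfPath.initial (p : E.InfPath) : ℕ → Leavitt E K
  | 0 => lvertex K p.source
  | m + 1 => InfPath.initial p m * ledge K (p.edge m)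

theorem InfPath.initial_mul_vertex (p : E.InfPath) (m : ℕ) :
    p.initial K m * lvertex K (E.s (p.edge m)) = p.initial K m := by
  cases m with
  | zero => exact vertex_mul_self K _
  | succ m => rw [← p.chain, InfPath.initial, mul_assoc, edge_mul_range]

theorem InfPath.source_mul_initial (p : E.InfPath) (m : ℕ) :
    lvertex K p.source * p.initial K m = p.initial K m := by
  induction m with
  | zero => exact vertex_mul_self K _
  | succ m ih => rw [InfPath.initial, ← mul_assoc, ih]

theorem InfPath.initial_succ (p : E.InfPath) (m : ℕ) :
    p.initial K (m + 1) = ledge K (p.edge 0) * p.tail.initial K m := by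
  induction m with
  | zero =>
    have h : p.tail.source = E.r (p.edge 0) := (p.chain 0).symm
    simp only [InfPath.initial]
    rw [h, edge_mul_range]
    exact source_mul_edge K _
  | succ m ih =>
    rw [InfPath.initial, ih, mul_assoc]
    rfl

theorem InfPath.initial_add (p q : E.InfPath) (m : ℕ) (h : ∀ i, p.edge (m + i) = q.edge i)
    (k : ℕ) : p.initial K (m + k) = p.initial K m * q.initial K k := by
  induction k with
  | zero =>
    rw [InfPath.initial, InfPath.source, ← h 0]
    exact (p.initial_mul_vertex K m).symm
  | succ k ih =>
    rw [InfPath.initial, ← mul_assoc, ← ih, ← h k]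
    rfl

theorem InfPath.initial_inf (e : E.ClosedPath) (k : ℕ) :
    e.inf.initial K (k + 1) = e.initialProduct K k := by
  induction k with
  | zero => exact source_mul_edge K _
  | succ k ih => rw [InfPath.initial, ih, ClosedPath.initialProduct]

theorem ghost_mul_edge_self (f : E.Edge) : lghost K f * ledge K f = lvertex K (E.r f) := by
  have h := gen_rel K (Rel.ck1 (K := K) f f)
  rw [if_pos rfl, map_mul] at h
  exact Leavitt.ext h

theorem ghost_mul_edge_of_ne {f g : E.Edge} (hfg : f ≠ g) : lghost K f * ledge K g = 0 := by
  have h := gen_rel K (Rel.ck1 (K := K) f g)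
  rw [if_neg hfg, map_mul, map_zero] at h
  exact Leavitt.ext h

theorem vertex_mul_vertex_of_ne {b c : E.Vertex} (hbc : b ≠ c) :
    lvertex K b * lvertex K c = 0 := by
  have h := gen_rel K (Rel.vertex_mul_vertex (K := K) b c hbc)
  rw [map_mul, map_zero] at h
  exact Leavitt.ext h

/-- For a simple closed path `e` of length `N`, the infinite path `e^∞` coincides with its shift by
`d` only if `N` divides `d`, because it passes through the base of `e` only at multiples of `N`. -/
theorem ClosedPath.IsSimple.dvd_of_shift {e : E.ClosedPath} (he : e.IsSimple) {d : ℕ}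
    (h : ∀ i, e.inf.edge (d + i) = e.inf.edge i) : e.n + 1 ∣ d := by
  have h0 : Fin.ofNat (e.n + 1) d = 0 := by
    by_contra hd
    refine he _ hd ?_
    have := h 0
    simp only [ClosedPath.inf, Nat.add_zero] at this
    rw [this]
    rfl
  exact Nat.dvd_of_mod_eq_zero (congrArg Fin.val h0)

/-- The class of `lam` modulo `L_K(E)(e - s(e))` depends only on the infinite path `lam e^∞`: two
choices of `lam` differ by a power of `e`. -/
theorem InfPath.initial_sub_mem {e : E.ClosedPath} (he : e.IsSimple) (p : E.InfPath) {m m' : ℕ}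
    (hm : ∀ i, p.edge (m + i) = e.inf.edge i) (hm' : ∀ i, p.edge (m' + i) = e.inf.edge i) :
    p.initial K m - p.initial K m' ∈ (LinearMap.mulRight K (relator K e 1)).range := by
  wlog hle : m ≤ m' generalizing m m'
  · rw [← neg_sub]
    exact neg_mem (this hm' hm (Nat.le_of_not_le hle))
  obtain ⟨d, rfl⟩ := Nat.exists_eq_add_of_le hle
  obtain ⟨c, rfl⟩ := he.dvd_of_shift (d := d) fun i => by rw [← hm, ← hm', Nat.add_assoc]
  clear hle hm'
  induction c with
  | zero => simp
  | succ c ih =>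
    have hc : ∀ i, p.edge (m + (e.n + 1) * c + i) = e.inf.edge i := by
      clear ih
      induction c with
      | zero => exact hm
      | succ c ih =>
        intro i
        rw [← e.inf_add_period, ← ih]
        congr 1
        ring
    have hstep : p.initial K (m + (e.n + 1) * (c + 1)) =
        p.initial K (m + (e.n + 1) * c) * e.elem K := by
      rw [Nat.mul_succ, ← Nat.add_assoc, p.initial_add K e.inf _ hc, initial_inf]
      rfl
    have hbase : p.initial K (m + (e.n + 1) * c) * lvertex K e.base =
        p.initial K (m + (e.n + 1) * c) := by
      have := p.initial_mul_vertex K (m + (e.n + 1) * c)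
      rw [show p.edge (m + (e.n + 1) * c) = e.inf.edge 0 from hc 0] at this
      exact this
    have hmem : p.initial K (m + (e.n + 1) * c) - p.initial K (m + (e.n + 1) * (c + 1)) ∈
        (LinearMap.mulRight K (relator K e 1)).range := by
      refine ⟨-p.initial K (m + (e.n + 1) * c), ?_⟩
      rw [LinearMap.mulRight_apply, hstep, relator, Units.val_one, inv_one, one_smul, mul_sub,
        neg_mul, neg_mul, hbase]
      abel
    have := add_mem ih hmem
    rwa [sub_add_sub_cancel] at this

end InitialSegment

/-! ### The annihilator of `e^∞` -/

section Annihilator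

variable {E : DirGraph.{u, v}} (K : Type w) [Field K] (e : E.ClosedPath)

theorem lvertex_smul (b : E.Vertex) (m : ChenModule K e) :
    lvertex K b • m = chenOp K e (Gen.vertex b) m :=
  DFunLike.congr_fun (chenRep_gen K e (Gen.vertex b)) m

theorem ledge_smul (f : E.Edge) (m : ChenModule K e) :
    ledge K f • m = chenOp K e (Gen.edge f) m :=
  DFunLike.congr_fun (chenRep_gen K e (Gen.edge f)) m

theorem smul_smul_chen (k : K) (l : Leavitt E K) (m : ChenModule K e) :
    (k • l) • m = k • l • m := by
  change chenRep K e (k • l).val m = k • chenRep K e l.val m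
  rw [map_smul, map_smul]
  rfl

variable {K e} in
theorem initial_smul (q q' : TailClass e) (m : ℕ)
    (h : ∀ i, q.1.edge (m + i) = q'.1.edge i) :
    q.1.initial K m • chenBasis K q' = chenBasis K q := by
  induction m generalizing q with
  | zero =>
    obtain rfl : q = q' := by
      obtain ⟨⟨p, hp⟩, hq⟩ := q
      obtain ⟨⟨p', hp'⟩, hq'⟩ := q'
      simp only [Subtype.mk.injEq, InfPath.mk.injEq]
      funext i
      simpa using h i
    rw [InfPath.initial, lvertex_smul, chenOp_vertex, if_pos rfl]
  | succ m ih =>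
    rw [InfPath.initial_succ, UnitalModule.mul_smul, ih ⟨q.1.tail, q.2.tail⟩, ledge_smul]
    · conv_rhs => rw [← edge_ghost_basis K e q, chenOp_ghost, if_pos rfl]
    · intro i
      rw [← h i]
      exact congrArg q.1.edge (by omega)

/-- The quotient `L_K(E) / L_K(E)(e - s(e))`. -/
abbrev RelatorQuotient : Type (max u v w) :=
  Leavitt E K ⧸ (LinearMap.mulRight K (relator K e 1)).range

/-- Left multiplication on `L_K(E) / L_K(E)(e - s(e))`. -/
noncomputable def quotientMulLeft (l : Leavitt E K) :
    RelatorQuotient K e →ₗ[K] RelatorQuotient K e :=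
  Submodule.mapQ _ _ (LinearMap.mulLeft K l) (by
    rintro _ ⟨y, rfl⟩
    exact ⟨l * y, mul_assoc l y _⟩)

/-- The linear map `V_{[e^∞]} → L_K(E) / L_K(E)(e - s(e))` that sends a basis vector `lam e^∞` to
the class of `lam`, for an arbitrary choice of `lam`. -/
noncomputable def chenToQuotient : ChenModule K e →ₗ[K] RelatorQuotient K e :=
  Finsupp.linearCombination K fun q : TailClass e =>
    (Submodule.Quotient.mk (q.1.initial K q.2.choose) : RelatorQuotient K e)

variable {K e}

theorem chenToQuotient_basis (he : e.IsSimple) (q : TailClass e) {m : ℕ}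
    (hm : ∀ i, q.1.edge (m + i) = e.inf.edge i) :
    chenToQuotient K e (chenBasis K q) = Submodule.Quotient.mk (q.1.initial K m) := by
  refine ((Finsupp.linearCombination_single K 1 q).trans (one_smul _ _)).trans ?_
  rw [Submodule.Quotient.eq]
  exact q.1.initial_sub_mem K he q.2.choose_spec hm

/-- It suffices to compare the two sides on generators of `L_K(E)` and basis vectors `lam e^∞`. For
a ghost edge, `lam` is chosen of positive length. -/
theorem chenToQuotient_smul (he : e.IsSimple) (l : Leavitt E K) (m : ChenModule K e) :
    chenToQuotient K e (l • m) = quotientMulLeft K e l (chenToQuotient K e m) := by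
  have key : ∀ g : E.Gen, (chenToQuotient K e).comp (chenOp K e g) =
      (quotientMulLeft K e ⟨gen E K g, gen_mem E K g⟩).comp (chenToQuotient K e) := by
    intro g
    refine Finsupp.lhom_ext' (M := K) (N := RelatorQuotient K e) fun q =>
      LinearMap.ext_ring ?_
    change chenToQuotient K e (chenOp K e g (chenBasis K q)) =
      quotientMulLeft K e _ (chenToQuotient K e (chenBasis K q))
    obtain ⟨m, hm⟩ := q.2
    cases g with
    | vertex b =>
      rw [chenToQuotient_basis he q hm, chenOp_vertex]
      change _ = Submodule.Quotient.mk (lvertex K b * q.1.initial K m)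
      by_cases hb : q.1.source = b
      · rw [if_pos hb, chenToQuotient_basis he q hm, ← hb, InfPath.source_mul_initial]
      · rw [if_neg hb, ← InfPath.source_mul_initial, ← mul_assoc,
          vertex_mul_vertex_of_ne K (Ne.symm hb), zero_mul, map_zero]
        rfl
    | edge f =>
      rw [chenToQuotient_basis he q hm, chenOp_edge]
      change _ = Submodule.Quotient.mk (ledge K f * q.1.initial K m)
      by_cases hf : E.r f = q.1.source
      · rw [dif_pos hf, chenToQuotient_basis he _ (m := m + 1), InfPath.initial_succ]
        · rfl
        · intro i
          rw [show m + 1 + i = (m + i) + 1 by omega]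
          exact hm i
      · rw [dif_neg hf, ← InfPath.source_mul_initial, ← edge_mul_range, mul_assoc,
          ← mul_assoc (lvertex K (E.r f)), vertex_mul_vertex_of_ne K hf, zero_mul, mul_zero,
          map_zero]
        rfl
    | ghost f =>
      have hm1 : ∀ i, q.1.edge (m + e.n + 1 + i) = e.inf.edge i := fun i => by
        rw [← e.inf_add_period, ← hm]
        exact congrArg q.1.edge (by omega)
      rw [chenToQuotient_basis he q hm1, chenOp_ghost, InfPath.initial_succ]
      change _ = Submodule.Quotient.mk (lghost K f * (ledge K (q.1.edge 0) *
        q.1.tail.initial K (m + e.n)))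
      rw [← mul_assoc]
      by_cases hf : q.1.edge 0 = f
      · rw [if_pos hf, chenToQuotient_basis he _ (m := m + e.n), hf, ghost_mul_edge_self, ← hf,
          q.1.chain 0]
        · exact congrArg _ (q.1.tail.source_mul_initial K _).symm
        · intro i
          rw [← hm1 i]
          exact congrArg q.1.edge (by omega)
      · rw [if_neg hf, ghost_mul_edge_of_ne K (Ne.symm hf), zero_mul, map_zero]
        rfl
  obtain ⟨l, hl⟩ := l
  induction hl using NonUnitalAlgebra.adjoin_induction generalizing m with
  | mem y hy =>
    obtain ⟨g, rfl⟩ := hy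
    have := DFunLike.congr_fun (key g) m
    rw [← chenRep_gen] at this
    exact this
  | add y z hy hz ihy ihz =>
    have h := UnitalModule.add_smul (A := Leavitt E K) ⟨y, hy⟩ ⟨z, hz⟩ m
    refine (congrArg _ h).trans ?_
    rw [map_add, ihy, ihz]
    induction chenToQuotient K e m using Submodule.Quotient.induction_on with
    | _ t => exact congrArg Submodule.Quotient.mk (add_mul (⟨y, hy⟩ : Leavitt E K) ⟨z, hz⟩ t).symm
  | zero =>
    have h : (0 : Leavitt E K) • m = 0 := by
      change chenRep K e (0 : Leavitt E K).val m = 0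
      rw [map_zero, map_zero]
      rfl
    refine (congrArg _ h).trans ?_
    rw [map_zero]
    induction chenToQuotient K e m using Submodule.Quotient.induction_on with
    | _ t => exact congrArg Submodule.Quotient.mk (zero_mul t).symm
  | mul y z hy hz ihy ihz =>
    have h := UnitalModule.mul_smul (A := Leavitt E K) ⟨y, hy⟩ ⟨z, hz⟩ m
    refine (congrArg _ h).trans ?_
    rw [ihy, ihz]
    induction chenToQuotient K e m using Submodule.Quotient.induction_on with
    | _ t => exact congrArg Submodule.Quotient.mk (mul_assoc (⟨y, hy⟩ : Leavitt E K) ⟨z, hz⟩ t).symm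
  | smul k y hy ih =>
    have h := smul_smul_chen K e k (⟨y, hy⟩ : Leavitt E K) m
    refine (congrArg _ h).trans ?_
    rw [map_smul, ih]
    induction chenToQuotient K e m using Submodule.Quotient.induction_on with
    | _ t => exact congrArg Submodule.Quotient.mk (smul_mul_assoc k (⟨y, hy⟩ : Leavitt E K) t).symm

/-- An element of `L_K(E) s(e)` that kills `e^∞` is a left multiple of `e - s(e)`: the map to the
quotient sends `y e^∞` to the class of `y`. -/
theorem mem_leftIdeal_of_smul_chenInf (he : e.IsSimple) {y : Leavitt E K}
    (hy : y * lvertex K e.base = y) (h : y • chenInf K e = 0) :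
    y ∈ leftIdeal (relator K e 1) := by
  have h1 := chenToQuotient_smul he y (chenInf K e)
  rw [h, map_zero, chenInf, chenToQuotient_basis he (m := 0) _ fun i => by rw [Nat.zero_add]] at h1
  have h2 : (0 : RelatorQuotient K e) = Submodule.Quotient.mk y :=
    h1.trans (congrArg Submodule.Quotient.mk hy)
  obtain ⟨t, ht⟩ := (Submodule.Quotient.mk_eq_zero _).1 h2.symm
  exact ⟨t, ht⟩

theorem base_smul_chenInf : lvertex K e.base • chenInf K e = chenInf K e :=
  initial_smul ⟨e.inf, InfPath.isTailOf_inf e⟩ ⟨e.inf, InfPath.isTailOf_inf e⟩ 0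
    fun i => by rw [Nat.zero_add]

theorem elem_smul_chenInf : e.elem K • chenInf K e = chenInf K e := by
  have := initial_smul (K := K) (e := e) ⟨e.inf, InfPath.isTailOf_inf e⟩
    ⟨e.inf, InfPath.isTailOf_inf e⟩ (e.n + 1) fun i => by rw [Nat.add_comm, e.inf_add_period]
  rw [InfPath.initial_inf] at this
  exact this

theorem relator_smul_chenInf : relator K e 1 • chenInf K e = 0 := by
  have h : relator K e 1 + lvertex K e.base = e.elem K := by
    rw [relator, Units.val_one, inv_one, one_smul, sub_add_cancel]
  have h2 := UnitalModule.add_smul (relator K e 1) (lvertex K e.base) (chenInf K e)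
  rw [h, elem_smul_chenInf, base_smul_chenInf] at h2
  exact right_eq_add.1 h2

theorem exists_smul_chenInf (m : ChenModule K e) : ∃ y : Leavitt E K, y • chenInf K e = m := by
  refine Finsupp.induction_linear (motive := fun m : TailClass e →₀ K =>
    ∃ y : Leavitt E K, y • chenInf K e = (show ChenModule K e from m)) m ?_ ?_ ?_
  · exact ⟨relator K e 1, relator_smul_chenInf⟩
  · rintro m n ⟨y, hy⟩ ⟨z, hz⟩
    exact ⟨y + z, (UnitalModule.add_smul y z _).trans (congrArg₂ (· + ·) hy hz)⟩
  · intro q k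
    obtain ⟨m, hm⟩ := q.2
    refine ⟨k • q.1.initial K m, ?_⟩
    rw [smul_smul_chen, chenInf, initial_smul q ⟨e.inf, InfPath.isTailOf_inf e⟩ m hm]
    exact Finsupp.smul_single_one q k

end Annihilator

/-! ### The gauge automorphism and the resolution -/

section Resolution

variable {E : DirGraph.{u, v}} {K : Type w} [Field K] {e : E.ClosedPath}

theorem gauge_smul (a : Kˣ) (k : K) (l : Leavitt E K) :
    gauge K e a (k • l) = k • gauge K e a l :=
  Leavitt.ext (map_smul (gaugeHom K (e.edge 0) a) k l.val)

theorem gauge_lvertex (a : Kˣ) (b : E.Vertex) : gauge K e a (lvertex K b) = lvertex K b :=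
  Leavitt.ext ((gaugeHom_gen K (e.edge 0) a (Gen.vertex b)).trans (one_smul K _))

theorem gauge_ledge_self (a : Kˣ) :
    gauge K e a (ledge K (e.edge 0)) = (a : K) • ledge K (e.edge 0) :=
  Leavitt.ext ((gaugeHom_gen K (e.edge 0) a (Gen.edge (e.edge 0))).trans
    (congrArg (· • gen E K (Gen.edge (e.edge 0))) (if_pos rfl)))

theorem gauge_ledge_of_ne (a : Kˣ) {f : E.Edge} (hf : f ≠ e.edge 0) :
    gauge K e a (ledge K f) = ledge K f :=
  Leavitt.ext ((gaugeHom_gen K (e.edge 0) a (Gen.edge f)).trans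
    ((congrArg (· • gen E K (Gen.edge f)) (if_neg hf)).trans (one_smul K _)))

/-- The first edge of a simple closed path occurs in it only once. -/
theorem gauge_initialProduct (he : e.IsSimple) (a : Kˣ) {k : ℕ} (hk : k ≤ e.n) :
    gauge K e a (e.initialProduct K k) = (a : K) • e.initialProduct K k := by
  induction k with
  | zero => exact gauge_ledge_self a
  | succ k ih =>
    have hne : e.inf.edge (k + 1) ≠ e.edge 0 := by
      intro h
      refine he (Fin.ofNat (e.n + 1) (k + 1)) ?_ (congrArg E.s h)
      intro h0
      have := congrArg Fin.val h0
      rw [Fin.val_ofNat, Nat.mod_eq_of_lt (by omega)] at this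
      exact absurd this (Nat.succ_ne_zero k)
    rw [ClosedPath.initialProduct, map_mul, ih (by omega), gauge_ledge_of_ne a hne,
      smul_mul_assoc]

theorem gauge_relator (he : e.IsSimple) (a : Kˣ) :
    gauge K e a (relator K e a) = relator K e 1 := by
  rw [relator, relator, map_sub, gauge_smul, gauge_lvertex, ClosedPath.elem,
    gauge_initialProduct he a le_rfl, smul_smul, inv_mul_cancel₀ a.ne_zero, Units.val_one, inv_one]

theorem resIncl_injective (a : Kˣ) : Function.Injective (resIncl K e a) := by
  intro y z h
  exact Subtype.ext (congrArg (fun t : leftIdeal (lvertex K e.base) => t.1) h)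

/-- Applying the gauge automorphism reduces the claim to `a = 1`. -/
theorem resolution_exact (he : e.IsSimple) (a : Kˣ) :
    Function.Exact (resIncl K e a) (resProj K e a) := by
  rintro ⟨y, hy⟩
  have hyb : y * lvertex K e.base = y := by
    obtain ⟨l, rfl⟩ := hy
    change l * lvertex K e.base * lvertex K e.base = l * lvertex K e.base
    rw [mul_assoc, vertex_mul_self]
  constructor
  · intro h
    obtain ⟨t, ht⟩ := mem_leftIdeal_of_smul_chenInf he
      (by rw [← gauge_lvertex (e := e) a e.base, ← map_mul, hyb])
      (show gauge K e a y • _ = _ from h)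
    have hy' : (gauge K e a).symm t * relator K e a = y := by
      apply (gauge K e a).injective
      rw [map_mul, gauge_relator he, RingEquiv.apply_symm_apply]
      exact ht
    exact ⟨⟨y, _, hy'⟩, rfl⟩
  · rintro ⟨⟨_, t, rfl⟩, h⟩
    obtain rfl : t * relator K e a = y :=
      congrArg (fun z : leftIdeal (lvertex K e.base) => z.1) h
    change gauge K e a (t * relator K e a) • chenInf K e = 0
    rw [map_mul, gauge_relator he, UnitalModule.mul_smul, relator_smul_chenInf]
    exact map_zero (chenRep K e (gauge K e a t).val)

theorem resProj_surjective (a : Kˣ) : Function.Surjective (resProj K e a) := by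
  intro m
  obtain ⟨y, hy⟩ := exists_smul_chenInf (UnitalModule.ofTwist (gauge K e a) m)
  refine ⟨⟨_, (gauge K e a).symm y, rfl⟩, ?_⟩
  change gauge K e a ((gauge K e a).symm y * lvertex K e.base) • chenInf K e = m
  rw [map_mul, RingEquiv.apply_symm_apply, gauge_lvertex, UnitalModule.mul_smul,
    base_smul_chenInf]
  exact hy

end Resolution

end DirGraph

theorem theorem3p3 (E : DirGraph.{u, v}) (K : Type w) [Field K] (e : E.ClosedPath)
    (he : e.IsSimple) (a : Kˣ) :
    UnitalModule.IsFinPres (DirGraph.Leavitt E K) (DirGraph.TwistedChen K e a) ∧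
    UnitalModule.IsProjective.{max u v w, max u v w, x} (DirGraph.Leavitt E K)
      (DirGraph.leftIdeal (DirGraph.relator K e a)) ∧
    UnitalModule.IsProjective.{max u v w, max u v w, x} (DirGraph.Leavitt E K)
      (DirGraph.leftIdeal (DirGraph.lvertex K e.base)) ∧
    Function.Injective (DirGraph.resIncl K e a) ∧
    Function.Exact (DirGraph.resIncl K e a) (DirGraph.resProj K e a) ∧
    Function.Surjective (DirGraph.resProj K e a) := by
  refine ⟨⟨_, _, inferInstance, inferInstance, inferInstance, inferInstance,
    DirGraph.resIncl K e a, DirGraph.resProj K e a,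
    DirGraph.isFinGen_leftIdeal ⟨_, DirGraph.base_mul_relator K e a⟩,
    DirGraph.isProjective_leftIdeal_relator K e a,
    DirGraph.isFinGen_leftIdeal ⟨_, DirGraph.vertex_mul_self K e.base⟩,
    DirGraph.isProjective_leftIdeal_vertex K e.base,
    DirGraph.resolution_exact he a, DirGraph.resProj_surjective a⟩,
    DirGraph.isProjective_leftIdeal_relator K e a,
    DirGraph.isProjective_leftIdeal_vertex K e.base,
    DirGraph.resIncl_injective a, DirGraph.resolution_exact he a, DirGraph.resProj_surjective a⟩
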